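/- A convex shape is a compact convex subset $K$ of the Euclidean plane with non-empty interior, and $\operatorname{per} K$ denotes its perimeter (the length of its boundary). A curve is a continuous image of $[0,1]$, parametrized, of finite length. A point of $K$ is extreme if it does not lie in any open (non-degenerate) line segment with end points in $K$. For every $\varepsilon>0$ there exists a positive integer $n$ such that for every convex shape $K$ one can choose $n$ extreme points of $K$, not necessarily distinct, with the property that no curve of length less than $\frac{1-\varepsilon}{2}\operatorname{per} K$ passes through all of them. -/

import Mathlib

/-- The Euclidean plane. -/
abbrev Plane : Type := EuclideanSpace ℝ (Fin 2)

/-- A convex shape: a compact convex subset of the plane with non-empty interior. -/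
structure IsConvexShape (K : Set Plane) : Prop where
  isCompact : IsCompact K
  convex : Convex ℝ K
  interior_nonempty : (interior K).Nonempty

/-- The perimeter of a planar set: the length of its boundary, that is, the one-dimensional
Hausdorff measure of the boundary (in Mathlib's normalization a segment has measure equal to
its length). -/
noncomputable def perimeter (K : Set Plane) : ENNReal :=
  MeasureTheory.Measure.hausdorffMeasure 1 (frontier K)

/-- The length of a parametrized curve `γ : [0, 1] → Plane`: the supremum of the lengths of
inscribed polygonal lines (infinite if the curve is not rectifiable). -/
noncomputable def curveLength (γ : C(unitInterval, Plane)) : ENNReal :=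
  eVariationOn γ Set.univ

/-- The curve `γ` connects the points `v 0, …, v (n - 1)`: it passes through each of them, in
whatever order. -/
def PassesThrough {n : ℕ} (γ : C(unitInterval, Plane)) (v : Fin n → Plane) : Prop :=
  ∀ i, v i ∈ Set.range γ

/-! Let `δ = π / M`, take the `2 * M` directions `j * δ`, and choose an extreme point of `K`
maximising each. With `S` the sum of the support function `h` over these directions, two bounds
meet. The circumscribed polygon with these normals has perimeter `2 * tan (δ / 2) * S`, which bounds
`perimeter K` (`IsConvexShape.perimeter_le`). Opposite directions pair up, so `S` is also the sum of
the `M` widths of the chosen points; by a discrete Cauchy-Crofton inequality a curve through them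
has length at least `sin (δ / 2) * S` (`PassesThrough.sum_width_le`). Hence the length is at least
`cos (δ / 2) / 2` times the perimeter, and `cos (δ / 2)` tends to 1 independently of `K`. -/

open scoped RealInnerProductSpace

/-- The unit vector of the plane at angle `θ`. -/
noncomputable def unitDir (θ : ℝ) : Plane := !₂[Real.cos θ, Real.sin θ]

lemma inner_unitDir (θ : ℝ) (x : Plane) :
    ⟪unitDir θ, x⟫ = Real.cos θ * x 0 + Real.sin θ * x 1 := by
  simp [unitDir, PiLp.inner_apply, Fin.sum_univ_two, mul_comm]

lemma inner_unitDir_add (θ δ : ℝ) (x : Plane) :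
    ⟪unitDir (θ + δ), x⟫ =
      Real.cos δ * ⟪unitDir θ, x⟫ + Real.sin δ * ⟪unitDir (θ + Real.pi / 2), x⟫ := by
  simp only [inner_unitDir, Real.cos_add, Real.sin_add, Real.cos_pi_div_two, Real.sin_pi_div_two]
  ring

lemma inner_unitDir_add_pi (θ : ℝ) (x : Plane) :
    ⟪unitDir (θ + Real.pi), x⟫ = -⟪unitDir θ, x⟫ := by
  simp only [inner_unitDir, Real.cos_add_pi, Real.sin_add_pi]
  ring

lemma unitDir_periodic : Function.Periodic unitDir (2 * Real.pi) := fun θ => by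
  simp [unitDir]

lemma norm_sq_eq_inner_unitDir (θ : ℝ) (x : Plane) :
    ‖x‖ ^ 2 = ⟪unitDir θ, x⟫ ^ 2 + ⟪unitDir (θ + Real.pi / 2), x⟫ ^ 2 := by
  rw [EuclideanSpace.norm_sq_eq, Fin.sum_univ_two]
  simp only [inner_unitDir, Real.cos_add_pi_div_two, Real.sin_add_pi_div_two, Real.norm_eq_abs,
    sq_abs]
  linear_combination (-(x 0) ^ 2 - (x 1) ^ 2) * Real.sin_sq_add_cos_sq θ

lemma exists_inner_unitDir_eq_norm_mul_cos (x : Plane) :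
    ∃ φ : ℝ, ∀ θ, ⟪unitDir θ, x⟫ = ‖x‖ * Real.cos (φ - θ) := by
  set z : ℂ := ⟨x 0, x 1⟩ with hz
  have hn : ‖x‖ = ‖z‖ := by
    rw [← sq_eq_sq₀ (norm_nonneg _) (norm_nonneg _), EuclideanSpace.norm_sq_eq, Fin.sum_univ_two,
      ← Complex.normSq_eq_norm_sq, Complex.normSq_apply]
    simp [hz, sq]
  refine ⟨z.arg, fun θ => ?_⟩
  have h0 : ‖z‖ * Real.cos z.arg = x 0 := Complex.norm_mul_cos_arg z
  have h1 : ‖z‖ * Real.sin z.arg = x 1 := Complex.norm_mul_sin_arg z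
  rw [inner_unitDir, hn, Real.cos_sub, ← h0, ← h1]
  ring

/-! ### Sums over equally spaced directions -/

lemma sum_range_add_step_of_periodic {f : ℝ → ℝ} {N : ℕ} {δ : ℝ}
    (hf : Function.Periodic f (N * δ)) (c : ℝ) :
    ∑ j ∈ Finset.range N, f (j * δ + c + δ) = ∑ j ∈ Finset.range N, f (j * δ + c) := by
  have h1 := Finset.sum_range_succ (fun j : ℕ => f (j * δ + c)) N
  have h2 := Finset.sum_range_succ' (fun j : ℕ => f (j * δ + c)) N
  have h3 : f (N * δ + c) = f c := by rw [add_comm]; exact hf c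
  have h4 : ∀ j : ℕ, f (((j + 1 : ℕ) : ℝ) * δ + c) = f (j * δ + c + δ) := fun j => by
    congr 1; push_cast; ring
  simp only [h4, h3, Nat.cast_zero, zero_mul, zero_add] at h1 h2
  linarith

/-- The sum has period `π / M` in `φ`; on a suitable period all cosines are nonnegative, and
multiplying by the sine makes the sum telescope. -/
lemma sum_abs_cos_mul_sin_le {M : ℕ} (hM : 0 < M) (φ : ℝ) :
    (∑ j ∈ Finset.range M, |Real.cos (φ - j * (Real.pi / M))|) * Real.sin (Real.pi / M / 2) ≤ 1 := by
  set δ := Real.pi / M with hδ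
  have hM' : (0 : ℝ) < M := by exact_mod_cast hM
  have hδ0 : 0 < δ := by positivity
  have hMδ : M * δ = Real.pi := by rw [hδ]; field_simp
  set F : ℝ → ℝ := fun φ => ∑ j ∈ Finset.range M, |Real.cos (φ - j * δ)| with hF
  have hper : Function.Periodic F δ := fun x => by
    have hc : Function.Periodic (fun t : ℝ => |Real.cos t|) (M * δ) := fun t => by
      simp [hMδ, Real.cos_add_pi]
    have h := sum_range_add_step_of_periodic hc (-(x + δ))
    simp only [hF]
    convert h.symm using 2 with j _ j _
    · rw [← Real.cos_neg]; congr 2; ring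
    · rw [← Real.cos_neg]; congr 2; ring
  obtain ⟨k, hk, -⟩ := existsUnique_add_zsmul_mem_Ico hδ0 φ (Real.pi / 2 - δ)
  set ψ := φ + k • δ with hψ
  have hFψ : F φ = F ψ := by
    rw [hψ, zsmul_eq_mul]; exact (hper.int_mul k φ).symm
  change F φ * _ ≤ 1
  rw [hFψ]
  have hcos : ∀ j ∈ Finset.range M, |Real.cos (ψ - j * δ)| = Real.cos (ψ - j * δ) := fun j hj => by
    have hj' : (j : ℝ) + 1 ≤ M := by exact_mod_cast Finset.mem_range.mp hj
    have h1 : (j + 1) * δ ≤ Real.pi := by rw [← hMδ]; gcongr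
    have h2 : 0 ≤ j * δ := by positivity
    refine abs_of_nonneg (Real.cos_nonneg_of_mem_Icc ⟨?_, ?_⟩) <;> linarith [hk.1, hk.2]
  have htel : 2 * ((∑ j ∈ Finset.range M, Real.cos (ψ - j * δ)) * Real.sin (δ / 2)) =
      2 * Real.sin (ψ + δ / 2) := by
    have hs := Finset.sum_range_sub' (fun j : ℕ => Real.sin (ψ + δ / 2 - j * δ)) M
    rw [hMδ, Real.sin_sub_pi, Nat.cast_zero, zero_mul, sub_zero] at hs
    rw [show 2 * Real.sin (ψ + δ / 2) = Real.sin (ψ + δ / 2) - -Real.sin (ψ + δ / 2) by ring, ← hs,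
      Finset.sum_mul, Finset.mul_sum]
    refine Finset.sum_congr rfl fun j _ => ?_
    rw [show ψ + δ / 2 - j * δ = (ψ - j * δ) + δ / 2 by ring,
      show ψ + δ / 2 - ((j + 1 : ℕ) : ℝ) * δ = (ψ - j * δ) - δ / 2 by push_cast; ring,
      Real.sin_add (ψ - j * δ), Real.sin_sub (ψ - j * δ)]
    ring
  simp only [hF]
  rw [Finset.sum_congr rfl hcos]
  linarith [Real.sin_le_one (ψ + δ / 2)]

lemma sum_abs_inner_unitDir_le {M : ℕ} (hM : 0 < M) (x : Plane) :
    (∑ j ∈ Finset.range M, |⟪unitDir (j * (Real.pi / M)), x⟫|) * Real.sin (Real.pi / M / 2) ≤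
      ‖x‖ := by
  obtain ⟨φ, hφ⟩ := exists_inner_unitDir_eq_norm_mul_cos x
  simp only [hφ, abs_mul, abs_norm]
  rw [← Finset.mul_sum, mul_assoc]
  exact mul_le_of_le_one_right (norm_nonneg _) (sum_abs_cos_mul_sin_le hM φ)

/-! ### Perimeter against the circumscribed polygon -/

/-- A ray issued from a point satisfying finitely many linear inequalities, one of which it
eventually violates, leaves the region they define at a point where one of them is an equality. -/
lemma exists_exit_time {ι : Type*} (s : Finset ι) (a c : ι → ℝ) (hc : ∀ i ∈ s, 0 ≤ c i)
    (ha : ∃ i ∈ s, 0 < a i) :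
    ∃ t : ℝ, 0 ≤ t ∧ (∀ i ∈ s, t * a i ≤ c i) ∧ ∃ i ∈ s, t * a i = c i := by
  obtain ⟨k, hk, hmin⟩ := (s.filter (0 < a ·)).exists_min_image (fun i => c i / a i)
    (by obtain ⟨i, hi, h⟩ := ha; exact ⟨i, by simp [hi, h]⟩)
  simp only [Finset.mem_filter] at hk hmin
  have ht : 0 ≤ c k / a k := div_nonneg (hc k hk.1) hk.2.le
  refine ⟨c k / a k, ht, fun i hi => ?_, k, hk.1, div_mul_cancel₀ _ hk.2.ne'⟩
  rcases lt_or_ge 0 (a i) with h | h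
  · exact (le_div_iff₀ h).mp (hmin i ⟨hi, h⟩)
  · exact (mul_nonpos_of_nonneg_of_nonpos ht h).trans (hc i hi)

/-- The directions come in opposite pairs, so otherwise `u` would be orthogonal to all of them,
including two independent ones. -/
lemma exists_inner_unitDir_pos {M : ℕ} (hM : 2 ≤ M) {u : Plane} (hu : u ≠ 0) :
    ∃ j ∈ Finset.range (2 * M), 0 < ⟪unitDir (j * (Real.pi / M)), u⟫ := by
  by_contra! hcon
  have hM' : (2 : ℝ) ≤ M := by exact_mod_cast hM
  have hz : ∀ j < M, ⟪unitDir (j * (Real.pi / M)), u⟫ = 0 := fun j hj => by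
    refine le_antisymm (hcon j (by simp; omega)) ?_
    have h := hcon (j + M) (by simp; omega)
    rw [show ((j + M : ℕ) : ℝ) * (Real.pi / M) = j * (Real.pi / M) + Real.pi by
      push_cast; field_simp, inner_unitDir_add_pi] at h
    linarith
  have h0 := hz 0 (by omega)
  have h1 := hz 1 (by omega)
  rw [Nat.cast_zero, zero_mul] at h0
  rw [Nat.cast_one, one_mul, ← zero_add (Real.pi / (M : ℝ)), inner_unitDir_add, h0, mul_zero,
    zero_add] at h1
  have hs : 0 < Real.sin (Real.pi / M) := by
    apply Real.sin_pos_of_pos_of_lt_pi (by positivity)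
    exact div_lt_self Real.pi_pos (by linarith)
  have h2 := (mul_eq_zero.mp h1).resolve_left hs.ne'
  have := norm_sq_eq_inner_unitDir 0 u
  rw [h0, h2] at this
  exact hu (norm_eq_zero.mp (by simpa using this))

lemma IsConvexShape.exists_outer_normal {K : Set Plane} (hK : IsConvexShape K) {x : Plane}
    (hx : x ∈ frontier K) : ∃ u : Plane, u ≠ 0 ∧ ∀ z ∈ K, ⟪u, z⟫ ≤ ⟪u, x⟫ := by
  obtain ⟨f, hf⟩ := geometric_hahn_banach_open_point hK.convex.interior isOpen_interior hx.2
  refine ⟨(InnerProductSpace.toDual ℝ Plane).symm f, fun h => ?_, fun z hz => ?_⟩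
  · obtain ⟨a, ha⟩ := hK.interior_nonempty
    have h1 := hf a ha
    rw [← InnerProductSpace.toDual_symm_apply, ← InnerProductSpace.toDual_symm_apply, h] at h1
    simp at h1
  · rw [InnerProductSpace.toDual_symm_apply, InnerProductSpace.toDual_symm_apply]
    have hz' : z ∈ closure (interior K) := by
      rw [hK.convex.closure_interior_eq_closure_of_nonempty_interior hK.interior_nonempty]
      exact subset_closure hz
    exact closure_minimal (t := {y | f y ≤ f x}) (fun a ha => (hf a ha).le)
      (isClosed_le f.continuous continuous_const) hz'

/-- The hypotheses make `x` and `x'` the nearest points of `K` to `y` and `y'` when `K` is convex;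
this is the contraction property of that projection. -/
lemma norm_sub_le_of_outer_normals {K : Set Plane} {x y x' y' : Plane} (hx : x ∈ K) (hx' : x' ∈ K)
    (h : ∀ z ∈ K, ⟪y - x, z - x⟫ ≤ 0) (h' : ∀ z ∈ K, ⟪y' - x', z - x'⟫ ≤ 0) :
    ‖x - x'‖ ≤ ‖y - y'‖ := by
  have h1 := h x' hx'
  have h2 := h' x hx
  have h3 : ⟪y - y', x - x'⟫ = ‖x - x'‖ ^ 2 - ⟪y - x, x' - x⟫ - ⟪y' - x', x - x'⟫ := by
    rw [← real_inner_self_eq_norm_sq]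
    simp only [inner_sub_left, inner_sub_right]
    ring
  have h4 := real_inner_le_norm (y - y') (x - x')
  rcases (norm_nonneg (x - x')).eq_or_lt with h0 | h0
  · rw [← h0]; exact norm_nonneg _
  · nlinarith

/-- A set that maps to a line of direction `unitDir (θ + π / 2)` by an expanding map whose image
lies in a segment of length `b - a` has one-dimensional measure at most `b - a`. -/
lemma hausdorffMeasure_le_of_expanding {A : Set Plane} {y : Plane → Plane} {θ c a b : ℝ}
    (hexp : ∀ x ∈ A, ∀ x' ∈ A, ‖x - x'‖ ≤ ‖y x - y x'‖)
    (hline : ∀ x ∈ A, ⟪unitDir θ, y x⟫ = c)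
    (hseg : ∀ x ∈ A, ⟪unitDir (θ + Real.pi / 2), y x⟫ ∈ Set.Icc a b) :
    MeasureTheory.Measure.hausdorffMeasure 1 A ≤ ENNReal.ofReal (b - a) := by
  let f : A → ℝ := fun x => ⟪unitDir (θ + Real.pi / 2), y x⟫
  have hf : AntilipschitzWith 1 f := by
    refine AntilipschitzWith.of_le_mul_dist fun x x' => ?_
    rw [Subtype.dist_eq, dist_eq_norm, NNReal.coe_one, one_mul, Real.dist_eq]
    refine (hexp x x.2 x' x'.2).trans (le_of_eq ?_)
    rw [← sq_eq_sq₀ (norm_nonneg _) (abs_nonneg _), norm_sq_eq_inner_unitDir θ, sq_abs,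
      inner_sub_right, inner_sub_right, hline x x.2, hline x' x'.2]
    simp [f]
  have h1 := hf.le_hausdorffMeasure_image zero_le_one (d := 1) Set.univ
  have h2 := (isometry_subtype_coe (s := A)).hausdorffMeasure_image (d := 1)
    (Or.inl zero_le_one) Set.univ
  rw [Set.image_univ, Subtype.range_coe] at h2
  rw [h2]
  refine h1.trans ?_
  rw [MeasureTheory.hausdorffMeasure_real, ENNReal.coe_one, ENNReal.one_rpow, one_mul,
    ← Real.volume_Icc]
  exact MeasureTheory.measure_mono (by rintro _ ⟨x, -, rfl⟩; exact hseg x x.2)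

/-- The perimeter of a convex shape is at most that of the circumscribed polygon whose `2 * M`
sides have equally spaced outer normals, expressed through the support function `h`. -/
lemma IsConvexShape.perimeter_le {K : Set Plane} (hK : IsConvexShape K) {h : ℝ → ℝ}
    (hle : ∀ θ, ∀ z ∈ K, ⟪unitDir θ, z⟫ ≤ h θ) (htight : ∀ θ, ∃ z ∈ K, ⟪unitDir θ, z⟫ = h θ)
    (hper : Function.Periodic h (2 * Real.pi)) {M : ℕ} (hM : 2 ≤ M) :
    perimeter K ≤ ENNReal.ofReal ((2 - 2 * Real.cos (Real.pi / M)) / Real.sin (Real.pi / M) *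
      ∑ j ∈ Finset.range (2 * M), h (j * (Real.pi / M))) := by
  have hM' : (2 : ℝ) ≤ M := by exact_mod_cast hM
  set δ := Real.pi / M with hδ
  have hMδ : ((2 * M : ℕ) : ℝ) * δ = 2 * Real.pi := by rw [hδ]; push_cast; field_simp
  have hs : 0 < Real.sin δ :=
    Real.sin_pos_of_pos_of_lt_pi (by positivity) (div_lt_self Real.pi_pos (by linarith))
  -- Push `x` along an outer normal until it reaches the boundary of the polygon, at `y`.
  have hy : ∀ x ∈ frontier K, ∃ y : Plane, (∀ z ∈ K, ⟪y - x, z - x⟫ ≤ 0) ∧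
      (∀ j ∈ Finset.range (2 * M), ⟪unitDir (j * δ), y⟫ ≤ h (j * δ)) ∧
      ∃ j ∈ Finset.range (2 * M), ⟪unitDir (j * δ), y⟫ = h (j * δ) := fun x hx => by
    obtain ⟨u, hu0, hu⟩ := hK.exists_outer_normal hx
    have hxK : x ∈ K := hK.isCompact.isClosed.frontier_subset hx
    obtain ⟨t, ht, h1, j, hj, h2⟩ := exists_exit_time (Finset.range (2 * M))
      (fun j => ⟪unitDir (j * δ), u⟫) (fun j => h (j * δ) - ⟪unitDir (j * δ), x⟫)
      (fun j _ => sub_nonneg.mpr (hle _ x hxK)) (exists_inner_unitDir_pos hM hu0)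
    refine ⟨x + t • u, fun z hz => ?_, fun j hj => ?_, j, hj, ?_⟩
    · rw [add_sub_cancel_left, real_inner_smul_left, inner_sub_right]
      exact mul_nonpos_of_nonneg_of_nonpos ht (sub_nonpos.mpr (hu z hz))
    · rw [inner_add_right, real_inner_smul_right]; linarith [h1 j hj]
    · rw [inner_add_right, real_inner_smul_right]; linarith
  choose! y hyn hyle hytight using hy
  -- The neighbours of the first and last directions wrap around modulo `2 * π`.
  have hall : ∀ x ∈ frontier K, ∀ j ∈ Finset.range (2 * M),
      ⟪unitDir (j * δ + δ), y x⟫ ≤ h (j * δ + δ) ∧ ⟪unitDir (j * δ - δ), y x⟫ ≤ h (j * δ - δ) := by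
    intro x hx j hj
    rw [Finset.mem_range] at hj
    constructor
    · rcases Nat.lt_or_ge (j + 1) (2 * M) with hj1 | hj1
      · have := hyle x hx (j + 1) (Finset.mem_range.mpr hj1)
        rwa [show ((j + 1 : ℕ) : ℝ) * δ = j * δ + δ by push_cast; ring] at this
      · have := hyle x hx 0 (Finset.mem_range.mpr (by omega))
        have hj2 : j + 1 = 2 * M := by omega
        rw [show (j : ℝ) * δ + δ = ((0 : ℕ) : ℝ) * δ + 2 * Real.pi by
          rw [← hMδ, ← hj2]; push_cast; ring, unitDir_periodic, hper]
        exact this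
    · rcases j with _ | j
      · have := hyle x hx (2 * M - 1) (Finset.mem_range.mpr (by omega))
        rw [← unitDir_periodic, ← hper, show ((0 : ℕ) : ℝ) * δ - δ + 2 * Real.pi =
          ((2 * M - 1 : ℕ) : ℝ) * δ by
            rw [← hMδ, Nat.cast_sub (by omega)]; push_cast; ring]
        exact this
      · have := hyle x hx j (Finset.mem_range.mpr (by omega))
        rwa [show ((j + 1 : ℕ) : ℝ) * δ - δ = j * δ by push_cast; ring]
  -- The side with normal `θ` lies between `a θ` and `b θ`, the coordinates where its line meets
  -- those of the normals `θ - δ` and `θ + δ`.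
  let b : ℝ → ℝ := fun θ => (h (θ + δ) - Real.cos δ * h θ) / Real.sin δ
  let a : ℝ → ℝ := fun θ => -((h (θ - δ) - Real.cos δ * h θ) / Real.sin δ)
  have hseg : ∀ θ (z : Plane), ⟪unitDir θ, z⟫ = h θ → ⟪unitDir (θ + δ), z⟫ ≤ h (θ + δ) →
      ⟪unitDir (θ - δ), z⟫ ≤ h (θ - δ) → ⟪unitDir (θ + Real.pi / 2), z⟫ ∈ Set.Icc (a θ) (b θ) := by
    intro θ z h0 h1 h2
    rw [inner_unitDir_add, h0] at h1
    rw [sub_eq_add_neg θ δ, inner_unitDir_add, h0, Real.cos_neg, Real.sin_neg,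
      ← sub_eq_add_neg θ δ] at h2
    simp only [a, b]
    constructor
    · rw [neg_le, le_div_iff₀ hs]; linarith
    · rw [le_div_iff₀ hs]; linarith
  -- By tightness `K` touches the line of this side, so the interval is nonempty.
  have hab : ∀ θ, 0 ≤ b θ - a θ := fun θ => by
    obtain ⟨z, hz, h0⟩ := htight θ
    have := hseg θ z h0 (hle _ z hz) (hle _ z hz)
    linarith [this.1, this.2]
  let A : ℕ → Set Plane := fun j => {x ∈ frontier K | ⟪unitDir (j * δ), y x⟫ = h (j * δ)}
  have hA : ∀ j ∈ Finset.range (2 * M), MeasureTheory.Measure.hausdorffMeasure 1 (A j) ≤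
      ENNReal.ofReal (b (j * δ) - a (j * δ)) := fun j hj =>
    hausdorffMeasure_le_of_expanding (y := y)
      (fun x hx x' hx' => norm_sub_le_of_outer_normals
        (hK.isCompact.isClosed.frontier_subset hx.1) (hK.isCompact.isClosed.frontier_subset hx'.1)
        (hyn x hx.1) (hyn x' hx'.1))
      (fun x hx => hx.2)
      (fun x hx => hseg _ _ hx.2 (hall x hx.1 j hj).1 (hall x hx.1 j hj).2)
  have hcover : frontier K ⊆ ⋃ j ∈ Finset.range (2 * M), A j := fun x hx => by
    obtain ⟨j, hj, hj'⟩ := hytight x hx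
    exact Set.mem_biUnion hj ⟨hx, hj'⟩
  have hsum : ∑ j ∈ Finset.range (2 * M), (b (j * δ) - a (j * δ)) =
      (2 - 2 * Real.cos δ) / Real.sin δ * ∑ j ∈ Finset.range (2 * M), h (j * δ) := by
    rw [← hMδ] at hper
    have h1 := sum_range_add_step_of_periodic hper 0
    have h2 := sum_range_add_step_of_periodic hper (-δ)
    simp only [add_zero, neg_add_cancel_right] at h1 h2
    simp only [← sub_eq_add_neg] at h2
    have h3 : ∀ j : ℕ, b (j * δ) - a (j * δ) =
        (h (j * δ + δ) + h (j * δ - δ) - 2 * Real.cos δ * h (j * δ)) / Real.sin δ := fun j => by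
      simp only [a, b]; ring
    simp only [h3]
    rw [← Finset.sum_div, Finset.sum_sub_distrib, Finset.sum_add_distrib, ← Finset.mul_sum, h1, ← h2]
    set S := ∑ j ∈ Finset.range (2 * M), h (j * δ)
    ring
  calc perimeter K ≤ MeasureTheory.Measure.hausdorffMeasure 1 (⋃ j ∈ Finset.range (2 * M), A j) :=
        MeasureTheory.measure_mono hcover
    _ ≤ ∑ j ∈ Finset.range (2 * M), MeasureTheory.Measure.hausdorffMeasure 1 (A j) :=
        MeasureTheory.measure_biUnion_finset_le _ _
    _ ≤ ∑ j ∈ Finset.range (2 * M), ENNReal.ofReal (b (j * δ) - a (j * δ)) :=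
        Finset.sum_le_sum hA
    _ = _ := by rw [← ENNReal.ofReal_sum_of_nonneg (fun j _ => hab _), hsum]

/-! ### Extreme points and lengths of curves -/

/-- The face of `K` where `⟪u, ·⟫` is maximal is compact, so it has an extreme point, which is
extreme in `K` too. -/
lemma IsCompact.exists_extremePoint_forall_inner_le {K : Set Plane} (hK : IsCompact K)
    (hne : K.Nonempty) (u : Plane) : ∃ p ∈ Set.extremePoints ℝ K, ∀ z ∈ K, ⟪u, z⟫ ≤ ⟪u, p⟫ := by
  set l : StrongDual ℝ Plane := innerSL ℝ u
  have hexp : IsExposed ℝ K (l.toExposed K) := ContinuousLinearMap.toExposed.isExposed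
  obtain ⟨x, hx, hmax⟩ := hK.exists_isMaxOn hne l.continuous.continuousOn
  obtain ⟨p, hp⟩ := (hexp.isCompact hK).extremePoints_nonempty ⟨x, hx, hmax⟩
  exact ⟨p, hexp.isExtreme.extremePoints_subset_extremePoints hp, hp.1.2⟩

lemma inner_sub_le_sum_abs (u : Plane) (q : ℕ → Plane) {a b n : ℕ} (ha : a ≤ n) (hb : b ≤ n) :
    ⟪u, q a⟫ - ⟪u, q b⟫ ≤ ∑ i ∈ Finset.range n, |⟪u, q (i + 1) - q i⟫| := by
  have key : ∀ {a b : ℕ}, a ≤ b → b ≤ n →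
      |⟪u, q a⟫ - ⟪u, q b⟫| ≤ ∑ i ∈ Finset.range n, |⟪u, q (i + 1) - q i⟫| := fun {a b} hab hb => by
    have h := dist_le_Ico_sum_dist (fun i => ⟪u, q i⟫) hab
    rw [Real.dist_eq] at h
    refine h.trans ((Finset.sum_le_sum_of_subset_of_nonneg (t := Finset.range n)
      (fun i hi => ?_) fun _ _ _ => dist_nonneg).trans_eq (Finset.sum_congr rfl fun i _ => ?_))
    · rw [Finset.mem_Ico] at hi; rw [Finset.mem_range]; omega
    · rw [dist_comm, Real.dist_eq, inner_sub_right]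
  rcases le_total a b with h | h
  · exact (le_abs_self _).trans (key h hb)
  · rw [← neg_sub]; exact (neg_le_abs _).trans (key h ha)

/-- A curve through `n` points is at least as long as some polygonal line through them. -/
lemma PassesThrough.exists_polygonal {n : ℕ} {γ : C(unitInterval, Plane)} {v : Fin n → Plane}
    (hγ : PassesThrough γ v) : ∃ q : ℕ → Plane, (∀ i, ∃ k ≤ n, q k = v i) ∧
      ∑ i ∈ Finset.range n, ENNReal.ofReal ‖q (i + 1) - q i‖ ≤ curveLength γ := by
  rcases Nat.eq_zero_or_pos n with rfl | hn
  · exact ⟨0, fun i => i.elim0, by simp⟩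
  choose t ht using hγ
  -- Visit the points in the order of their parameters. Clamping the index in `c` makes the last of
  -- the `n` segments degenerate.
  let σ := Tuple.sort t
  let c : ℕ → Fin n := fun i => ⟨min i (n - 1), by omega⟩
  have hc : Monotone c := fun i j hij => by
    rw [Fin.le_def]; exact min_le_min_right _ hij
  refine ⟨fun i => γ (t (σ (c i))), fun i => ?_, ?_⟩
  · refine ⟨σ.symm i, (σ.symm i).2.le, ?_⟩
    have : c (σ.symm i) = σ.symm i := by
      ext; simp only [c]; have := (σ.symm i).2; omega
    simp only [this, Equiv.apply_symm_apply, ht]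
  · have := eVariationOn.sum_le (f := γ) (s := Set.univ) (n := n)
      ((Tuple.monotone_sort t).comp hc) (fun _ => Set.mem_univ _)
    simp only [edist_dist, dist_eq_norm] at this
    exact this

/-- The Cauchy-Crofton estimate with finitely many directions: a curve through points `v i` has
length controlling the sum of the widths of the set of these points. -/
lemma PassesThrough.sum_width_le {M : ℕ} (hM : 0 < M) {γ : C(unitInterval, Plane)} {n : ℕ}
    {v : Fin n → Plane} (hγ : PassesThrough γ v) {a b : ℕ → Plane}
    (ha : ∀ j < M, a j ∈ Set.range v) (hb : ∀ j < M, b j ∈ Set.range v) :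
    ENNReal.ofReal ((∑ j ∈ Finset.range M, (⟪unitDir (j * (Real.pi / M)), a j⟫ -
      ⟪unitDir (j * (Real.pi / M)), b j⟫)) * Real.sin (Real.pi / M / 2)) ≤ curveLength γ := by
  obtain ⟨q, hq, hlen⟩ := hγ.exists_polygonal
  choose k hkn hk using hq
  refine le_trans ?_ hlen
  rw [← ENNReal.ofReal_sum_of_nonneg fun _ _ => norm_nonneg _]
  refine ENNReal.ofReal_le_ofReal ?_
  have hM' : (1 : ℝ) ≤ M := by exact_mod_cast hM
  have hs : 0 ≤ Real.sin (Real.pi / M / 2) := by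
    apply Real.sin_nonneg_of_nonneg_of_le_pi (by positivity)
    linarith [div_le_self Real.pi_pos.le hM', Real.pi_pos]
  calc _ ≤ (∑ j ∈ Finset.range M, ∑ i ∈ Finset.range n,
          |⟪unitDir (j * (Real.pi / M)), q (i + 1) - q i⟫|) * Real.sin (Real.pi / M / 2) := by
        refine mul_le_mul_of_nonneg_right (Finset.sum_le_sum fun j hj => ?_) hs
        obtain ⟨i, hi⟩ := ha j (Finset.mem_range.mp hj)
        obtain ⟨i', hi'⟩ := hb j (Finset.mem_range.mp hj)
        rw [← hi, ← hi', ← hk, ← hk]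
        exact inner_sub_le_sum_abs _ q (hkn _) (hkn _)
    _ = ∑ i ∈ Finset.range n, (∑ j ∈ Finset.range M,
          |⟪unitDir (j * (Real.pi / M)), q (i + 1) - q i⟫|) * Real.sin (Real.pi / M / 2) := by
        rw [Finset.sum_comm, Finset.sum_mul]
    _ ≤ _ := Finset.sum_le_sum fun i _ => sum_abs_inner_unitDir_le hM _

/-! ### Choice of `M` and conclusion -/

lemma exists_cos_pi_div_ge {ε : ℝ} (hε : 0 < ε) :
    ∃ M : ℕ, 2 ≤ M ∧ 1 - ε ≤ Real.cos (Real.pi / M / 2) := by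
  have hlim : Filter.Tendsto (fun M : ℕ => Real.cos (Real.pi / M / 2)) Filter.atTop (nhds 1) := by
    have h := (tendsto_const_div_atTop_nhds_zero_nat Real.pi).div_const 2
    rw [zero_div] at h
    have h' := (Real.continuous_cos.tendsto 0).comp h
    rwa [Real.cos_zero] at h'
  have h1 := hlim.eventually (lt_mem_nhds (show 1 - ε < 1 by linarith))
  obtain ⟨M, hM, hc⟩ := ((Filter.eventually_ge_atTop 2).and h1).exists
  exact ⟨M, hM, hc.le⟩

theorem theorem4 (ε : ℝ) (hε : 0 < ε) :
    ∃ n : ℕ, 0 < n ∧ ∀ K : Set Plane, IsConvexShape K →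
      ∃ v : Fin n → Plane, (∀ i, v i ∈ Set.extremePoints ℝ K) ∧
        ¬ ∃ γ : C(unitInterval, Plane), PassesThrough γ v ∧
          curveLength γ < ENNReal.ofReal ((1 - ε) / 2) * perimeter K := by
  obtain ⟨M, hM, hcos⟩ := exists_cos_pi_div_ge hε
  refine ⟨2 * M, by omega, fun K hK => ?_⟩
  have hne : K.Nonempty := hK.interior_nonempty.mono interior_subset
  choose p hp hmax using hK.isCompact.exists_extremePoint_forall_inner_le hne
  set δ := Real.pi / M with hδ
  refine ⟨fun i => p (unitDir ((i : ℕ) * δ)), fun i => hp _, ?_⟩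
  rintro ⟨γ, hγ, hlt⟩
  refine hlt.not_ge ?_
  have hM' : (2 : ℝ) ≤ M := by exact_mod_cast hM
  have hδ0 : 0 < δ := by positivity
  have hδ2 : δ ≤ Real.pi / 2 := by rw [hδ]; gcongr
  have hMδ : M * δ = Real.pi := by rw [hδ]; field_simp
  have hs : 0 < Real.sin (δ / 2) := Real.sin_pos_of_pos_of_lt_pi (by linarith) (by linarith)
  have hc : 0 < Real.cos (δ / 2) := Real.cos_pos_of_mem_Ioo ⟨by linarith, by linarith⟩
  set h : ℝ → ℝ := fun θ => ⟪unitDir θ, p (unitDir θ)⟫ with hh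
  have hperim := hK.perimeter_le (h := h) (fun θ z hz => hmax _ z hz)
    (fun θ => ⟨_, extremePoints_subset (hp _), rfl⟩)
    (fun θ => by simp only [hh, unitDir_periodic θ]) hM
  -- The point chosen for direction `j + M`, opposite to `j`, minimises direction `j`.
  have hlen := hγ.sum_width_le (by omega : 0 < M) (a := fun j => p (unitDir (j * δ)))
    (b := fun j => p (unitDir ((j + M : ℕ) * δ)))
    (fun j hj => ⟨⟨j, by omega⟩, rfl⟩) (fun j hj => ⟨⟨j + M, by omega⟩, rfl⟩)
  rw [← hδ] at hperim hlen
  set S := ∑ j ∈ Finset.range (2 * M), h (j * δ) with hS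
  have hwidth : ∑ j ∈ Finset.range M, (⟪unitDir (j * δ), p (unitDir (j * δ))⟫ -
      ⟪unitDir (j * δ), p (unitDir ((j + M : ℕ) * δ))⟫) = S := by
    rw [hS, two_mul, Finset.sum_range_add, ← Finset.sum_add_distrib]
    refine Finset.sum_congr rfl fun j _ => ?_
    have harg : ((M + j : ℕ) : ℝ) * δ = j * δ + Real.pi := by rw [← hMδ]; push_cast; ring
    rw [add_comm j M]
    simp only [hh, harg]
    rw [inner_unitDir_add_pi, sub_eq_add_neg]
  have hS0 : 0 ≤ S := by
    rw [← hwidth]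
    exact Finset.sum_nonneg fun j _ => sub_nonneg.mpr (hmax _ _ (extremePoints_subset (hp _)))
  rw [hwidth] at hlen
  refine le_trans ?_ hlen
  -- Both sides are `2 * tan (δ / 2)`; its sine cancels against the one in `hlen`, leaving `cos (δ /
  -- 2)`.
  have htan : (2 - 2 * Real.cos δ) / Real.sin δ = 2 * Real.sin (δ / 2) / Real.cos (δ / 2) := by
    have h1 : Real.sin δ = 2 * Real.sin (δ / 2) * Real.cos (δ / 2) := by
      rw [← Real.sin_two_mul]; congr 1; ring
    have h2 : Real.cos δ = 1 - 2 * Real.sin (δ / 2) ^ 2 := by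
      rw [← Real.cos_two_mul_eq_one_sub]; congr 1; ring
    rw [h1, h2]
    field_simp
    ring
  rw [htan] at hperim
  -- For `ε ≥ 1` the factor is truncated to `0` by `ENNReal.ofReal`.
  rcases le_total (1 - ε) 0 with hε1 | hε1
  · rw [ENNReal.ofReal_of_nonpos (by linarith), zero_mul]
    exact zero_le
  · refine (mul_le_mul_right hperim _).trans ?_
    rw [← ENNReal.ofReal_mul (by linarith)]
    refine ENNReal.ofReal_le_ofReal ?_
    calc (1 - ε) / 2 * (2 * Real.sin (δ / 2) / Real.cos (δ / 2) * S)
        = (1 - ε) * (S * Real.sin (δ / 2) / Real.cos (δ / 2)) := by ring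
      _ ≤ Real.cos (δ / 2) * (S * Real.sin (δ / 2) / Real.cos (δ / 2)) := by gcongr
      _ = S * Real.sin (δ / 2) := by field_simp
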